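/- **Setting.** Let $\delta>0$ and let $\Omega:[0,\infty)\to[0,1]$ satisfy $\Omega(0)=1$, $\Omega(\varepsilon)<1$ for $\varepsilon>0$, and $\Omega(\varepsilon+\varepsilon')\le\Omega(\varepsilon)\Omega(\varepsilon')$. On the cone $(\mathbb R\times[0,\infty))/(\mathbb R\times\{0\})$ put $$d_\delta([a,r],[b,s])^2=4\delta^2\Big(r^2+s^2-2rs\,\Omega\Big(\frac{|a-b|}{2\delta}\Big)\Big).$$ A *measure network* $\mathcal N_X=(X,\mu_X,\omega_X)$ is a compact Polish space $X$ with a finite Borel measure $\mu_X$ and a bounded measurable function $\omega_X:X\times X\to[0,\infty)$. A *measure hypernetwork* $(X,\mu_X,X',\mu_X',\omega_X)$ consists of two compact Polish spaces with finite Borel measures and a bounded measurable $\omega_X:X\times X'\to[0,\infty)$; a measure network is viewed as the hypernetwork $\mathcal H_X=(X,\mu_X,X,\mu_X,\omega_X)$. A *semi-coupling* of $\mu_X$ and $\mu_Y$ is a pair $(\gamma_0,\gamma_1)$ of positive measures on $X\times Y$ such that the first marginal of $\gamma_0$ is $\mu_X$ and the second marginal of $\gamma_1$ is $\mu_Y$;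 the set of them is $\Gamma(\mu_X,\mu_Y)$. For hypernetworks $(X,\mu_X,X',\mu_X',\omega_X)$, $(Y,\mu_Y,Y',\mu_Y',\omega_Y)$ and $(\gamma_0,\gamma_1)\in\Gamma(\mu_X,\mu_Y)$, $(\gamma_0',\gamma_1')\in\Gamma(\mu_X',\mu_Y')$, the CCOT loss $\mathbf L_\delta(\gamma_0,\gamma_1,\gamma_0',\gamma_1')$ is $$\int d_\delta\Big(\Big[\omega_X(x,x'),\sqrt{\tfrac{d\gamma_0}{d\gamma}(x,y)\tfrac{d\gamma_0'}{d\gamma'}(x',y')}\Big],\Big[\omega_Y(y,y'),\sqrt{\tfrac{d\gamma_1}{d\gamma}(x,y)\tfrac{d\gamma_1'}{d\gamma'}(x',y')}\Big]\Big)^2d\gamma(x,y)\,d\gamma'(x',y'),$$ where $\gamma$ is any reference measure with $\gamma_0,\gamma_1\ll\gamma$ and $\gamma'$ any reference measure with $\gamma_0',\gamma_1'\ll\gamma'$ (the value does not depend on the choice). Put $\mathsf{CCOT}_\delta=\inf \mathbf L_\delta(\gamma_0,\gamma_1,\gamma_0',\gamma_1')^{1/2}$, the infimum over all pairs of semi-couplings.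 For measure networks, the CGW loss $\mathbf H_\delta(\gamma_0,\gamma_1)$ is given by the same integral with $X'=X$, $Y'=Y$, $\gamma'=\gamma$, $\gamma_i'=\gamma_i$, and $\mathsf{CGW}_\delta(\mathcal N_X,\mathcal N_Y)=\inf_{(\gamma_0,\gamma_1)\in\Gamma(\mu_X,\mu_Y)}\mathbf H_\delta(\gamma_0,\gamma_1)^{1/2}$. (An infimum over the empty set is $+\infty$.) **Theorem.** Let $\mathcal N_X,\mathcal N_Y$ be measure networks with associated hypernetworks $\mathcal H_X,\mathcal H_Y$. Suppose that $$k\big((x,y),(x',y')\big)=\Omega\Big(\frac{|\omega_X(x,x')-\omega_Y(y,y')|}{2\delta}\Big)$$ is a positive definite kernel on $X\times Y$, i.e. $k$ is symmetric and $\sum_{i,j}c_ic_jk(z_i,z_j)\ge0$ for all finite families of points $z_i\in X\times Y$ and reals $c_i$. Then for all $(\gamma_0,\gamma_1),(\gamma_0',\gamma_1')\in\Gamma(\mu_X,\mu_Y)$ with $\mathsf{CCOT}_\delta(\mathcal H_X,\mathcal H_Y)=\mathbf L_\delta(\gamma_0,\gamma_1,\gamma_0',\gamma_1')^{1/2}$,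 $$\mathsf{CCOT}_\delta(\mathcal H_X,\mathcal H_Y)=\mathbf L_\delta(\gamma_0,\gamma_1,\gamma_0,\gamma_1)^{1/2}=\mathbf L_\delta(\gamma_0',\gamma_1',\gamma_0',\gamma_1')^{1/2}=\mathbf H_\delta(\gamma_0,\gamma_1)^{1/2}=\mathbf H_\delta(\gamma_0',\gamma_1')^{1/2}.$$ Moreover, $\mathsf{CCOT}_\delta(\mathcal H_X,\mathcal H_Y)=\mathsf{CGW}_\delta(\mathcal N_X,\mathcal N_Y)$. -/

import Mathlib

open MeasureTheory
open scoped NNReal ENNReal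

/-! ### Cones and cone distances -/

/-- The axioms on the function `Ω : [0, ∞) → [0, 1]` that enters a cone distance.  `Ω` is
represented by a function on `ℝ`, of which only the values on `[0, ∞)` are ever used. -/
structure IsConeFunction (Ω : ℝ → ℝ) : Prop where
  mem_Icc : ∀ z, 0 ≤ z → Ω z ∈ Set.Icc (0 : ℝ) 1
  map_zero : Ω 0 = 1
  lt_one : ∀ ε, 0 < ε → Ω ε < 1
  map_add_le : ∀ ε ε', 0 ≤ ε → 0 ≤ ε' → Ω (ε + ε') ≤ Ω ε * Ω ε'

/-- The relation on `X × [0, ∞)` that collapses `X × {0}` to a point. -/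
def coneSetoid (X : Type*) : Setoid (X × ℝ≥0) where
  r p q := p = q ∨ (p.2 = 0 ∧ q.2 = 0)
  iseqv :=
    { refl := fun _ => Or.inl rfl
      symm := by
        rintro p q (h | ⟨h, h'⟩)
        · exact Or.inl h.symm
        · exact Or.inr ⟨h', h⟩
      trans := by
        rintro p q r (rfl | ⟨h, h'⟩) (rfl | ⟨k, k'⟩)
        · exact Or.inl rfl
        · exact Or.inr ⟨k, k'⟩
        · exact Or.inr ⟨h, h'⟩
        · exact Or.inr ⟨h, k'⟩ }

/-- The cone `(X × [0, ∞)) / (X × {0})` over `X`. -/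
def MetricCone (X : Type*) : Type _ := Quotient (coneSetoid X)

/-- The point `[x, r]` of the cone. -/
def MetricCone.mk {X : Type*} (x : X) (r : ℝ≥0) : MetricCone X :=
  Quotient.mk (coneSetoid X) (x, r)

/-- The cone distance, with
`d([x, r], [y, s])² = 4δ² (r² + s² - 2 r s Ω(d(x, y) / (2δ)))`. -/
noncomputable def coneDist {X : Type*} [MetricSpace X] (Ω : ℝ → ℝ) (δ : ℝ) :
    MetricCone X → MetricCone X → ℝ :=
  Quotient.lift₂ (s₁ := coneSetoid X) (s₂ := coneSetoid X)
    (fun p q => √(4 * δ ^ 2 * ((p.2 : ℝ) ^ 2 + (q.2 : ℝ) ^ 2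
      - 2 * (p.2 : ℝ) * (q.2 : ℝ) * Ω (dist p.1 q.1 / (2 * δ)))))
    (by
      rintro p q p' q' (rfl | ⟨h, h'⟩) (rfl | ⟨k, k'⟩)
      · rfl
      · simp [k, k']
      · simp [h, h']
      · simp [h, h', k, k'])

/-! ### Measure networks and measure hypernetworks -/

/-- A measure network structure `(X, μ, ω)` on a compact Polish space `X`: a finite Borel measure
and a bounded measurable kernel `ω : X × X → [0, ∞)`. -/
structure MeasureNetwork (X : Type*) [TopologicalSpace X] [CompactSpace X] [PolishSpace X]
    [MeasurableSpace X] [BorelSpace X] where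
  μ : Measure X
  finite_μ : IsFiniteMeasure μ
  ω : X × X → ℝ
  measurable_ω : Measurable ω
  nonneg_ω : ∀ p, 0 ≤ ω p
  bounded_ω : ∃ C, ∀ p, ω p ≤ C

/-- A measure hypernetwork structure `(X, μ, X', μ', ω)` on compact Polish spaces `X`, `X'`: finite
Borel measures on both and a bounded measurable kernel `ω : X × X' → [0, ∞)`. -/
structure MeasureHypernetwork (X X' : Type*) [TopologicalSpace X] [CompactSpace X] [PolishSpace X]
    [MeasurableSpace X] [BorelSpace X] [TopologicalSpace X'] [CompactSpace X'] [PolishSpace X']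
    [MeasurableSpace X'] [BorelSpace X'] where
  μ : Measure X
  finite_μ : IsFiniteMeasure μ
  μ' : Measure X'
  finite_μ' : IsFiniteMeasure μ'
  ω : X × X' → ℝ
  measurable_ω : Measurable ω
  nonneg_ω : ∀ p, 0 ≤ ω p
  bounded_ω : ∃ C, ∀ p, ω p ≤ C

/-- The measure network `(X, μ, ω)` viewed as the hypernetwork `(X, μ, X, μ, ω)`. -/
def MeasureNetwork.toHypernetwork {X : Type*} [TopologicalSpace X] [CompactSpace X] [PolishSpace X]
    [MeasurableSpace X] [BorelSpace X] (N : MeasureNetwork X) : MeasureHypernetwork X X where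
  μ := N.μ
  finite_μ := N.finite_μ
  μ' := N.μ
  finite_μ' := N.finite_μ
  ω := N.ω
  measurable_ω := N.measurable_ω
  nonneg_ω := N.nonneg_ω
  bounded_ω := N.bounded_ω

/-! ### Semi-couplings -/

/-- The set of semi-couplings: pairs `(γ₀, γ₁)` of positive measures on `X × Y` such that the first
marginal of `γ₀` is `μ` and the second marginal of `γ₁` is `ν`.  (If `μ` and `ν` are finite, then
so are `γ₀` and `γ₁`.) -/
def semiCouplings {X Y : Type*} [MeasurableSpace X] [MeasurableSpace Y]
    (μ : Measure X) (ν : Measure Y) : Set (Measure (X × Y) × Measure (X × Y)) :=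
  {g | g.1.map Prod.fst = μ ∧ g.2.map Prod.snd = ν}

section Losses

variable {X X' Y Y' : Type*}
  [TopologicalSpace X] [CompactSpace X] [PolishSpace X] [MeasurableSpace X] [BorelSpace X]
  [TopologicalSpace X'] [CompactSpace X'] [PolishSpace X'] [MeasurableSpace X'] [BorelSpace X']
  [TopologicalSpace Y] [CompactSpace Y] [PolishSpace Y] [MeasurableSpace Y] [BorelSpace Y]
  [TopologicalSpace Y'] [CompactSpace Y'] [PolishSpace Y'] [MeasurableSpace Y'] [BorelSpace Y']

/-! ### The conic Gromov-Wasserstein distance -/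

/-- The CGW loss of `g = (γ₀, γ₁)`, computed with the reference measure `γ`: the integral over
`(X × Y)²`, against `γ ⊗ γ`, of the squared cone distance between
`[ω_X(x, x'), √(dγ₀/dγ(x, y) dγ₀/dγ(x', y'))]` and
`[ω_Y(y, y'), √(dγ₁/dγ(x, y) dγ₁/dγ(x', y'))]`. -/
noncomputable def cgwLossRef (Ω : ℝ → ℝ) (δ : ℝ) (NX : MeasureNetwork X) (NY : MeasureNetwork Y)
    (γ : Measure (X × Y)) (g : Measure (X × Y) × Measure (X × Y)) : ℝ≥0∞ :=
  ∫⁻ z : (X × Y) × (X × Y), ENNReal.ofReal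
    (coneDist Ω δ
      (MetricCone.mk (NX.ω (z.1.1, z.2.1))
        (NNReal.sqrt ((g.1.rnDeriv γ z.1).toNNReal * (g.1.rnDeriv γ z.2).toNNReal)))
      (MetricCone.mk (NY.ω (z.1.2, z.2.2))
        (NNReal.sqrt ((g.2.rnDeriv γ z.1).toNNReal * (g.2.rnDeriv γ z.2).toNNReal))) ^ 2)
    ∂(γ.prod γ)

/-- The CGW loss `H_δ(γ₀, γ₁)`, with the reference measure `γ₀ + γ₁`.  Any other σ-finite reference
measure dominating `γ₀` and `γ₁` gives the same value, see `cgwLossRef_eq_cgwLoss`. -/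
noncomputable def cgwLoss (Ω : ℝ → ℝ) (δ : ℝ) (NX : MeasureNetwork X) (NY : MeasureNetwork Y)
    (g : Measure (X × Y) × Measure (X × Y)) : ℝ≥0∞ :=
  cgwLossRef Ω δ NX NY (g.1 + g.2) g

/-- The conic Gromov-Wasserstein distance `CGW_δ`: the infimum of `H_δ(γ₀, γ₁)^{1/2}` over all
semi-couplings. -/
noncomputable def CGW (Ω : ℝ → ℝ) (δ : ℝ) (NX : MeasureNetwork X) (NY : MeasureNetwork Y) : ℝ≥0∞ :=
  ⨅ g ∈ semiCouplings NX.μ NY.μ, cgwLoss Ω δ NX NY g ^ (1 / 2 : ℝ)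

/-! ### The conic co-optimal transport distance -/

/-- The CCOT loss of `g = (γ₀, γ₁)` and `g' = (γ₀', γ₁')`, computed with the reference measures `γ`
and `γ'`: the integral over `X × Y × X' × Y'`, against `γ ⊗ γ'`, of the squared cone distance
between `[ω_X(x, x'), √(dγ₀/dγ(x, y) dγ₀'/dγ'(x', y'))]` and
`[ω_Y(y, y'), √(dγ₁/dγ(x, y) dγ₁'/dγ'(x', y'))]`. -/
noncomputable def ccotLossRef (Ω : ℝ → ℝ) (δ : ℝ) (HX : MeasureHypernetwork X X')
    (HY : MeasureHypernetwork Y Y') (γ : Measure (X × Y)) (γ' : Measure (X' × Y'))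
    (g : Measure (X × Y) × Measure (X × Y)) (g' : Measure (X' × Y') × Measure (X' × Y')) : ℝ≥0∞ :=
  ∫⁻ z : (X × Y) × (X' × Y'), ENNReal.ofReal
    (coneDist Ω δ
      (MetricCone.mk (HX.ω (z.1.1, z.2.1))
        (NNReal.sqrt ((g.1.rnDeriv γ z.1).toNNReal * (g'.1.rnDeriv γ' z.2).toNNReal)))
      (MetricCone.mk (HY.ω (z.1.2, z.2.2))
        (NNReal.sqrt ((g.2.rnDeriv γ z.1).toNNReal * (g'.2.rnDeriv γ' z.2).toNNReal))) ^ 2)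
    ∂(γ.prod γ')

/-- The CCOT loss `L_δ(γ₀, γ₁, γ₀', γ₁')`, with the reference measures `γ₀ + γ₁` and `γ₀' + γ₁'`.
Any other σ-finite reference measures dominating `γ₀, γ₁` and `γ₀', γ₁'`, respectively, give the
same value, see `ccotLossRef_eq_ccotLoss`. -/
noncomputable def ccotLoss (Ω : ℝ → ℝ) (δ : ℝ) (HX : MeasureHypernetwork X X')
    (HY : MeasureHypernetwork Y Y')
    (g : Measure (X × Y) × Measure (X × Y)) (g' : Measure (X' × Y') × Measure (X' × Y')) : ℝ≥0∞ :=
  ccotLossRef Ω δ HX HY (g.1 + g.2) (g'.1 + g'.2) g g'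

/-- The conic co-optimal transport distance `CCOT_δ`: the infimum of
`L_δ(γ₀, γ₁, γ₀', γ₁')^{1/2}` over all pairs of semi-couplings. -/
noncomputable def CCOT (Ω : ℝ → ℝ) (δ : ℝ) (HX : MeasureHypernetwork X X')
    (HY : MeasureHypernetwork Y Y') : ℝ≥0∞ :=
  ⨅ g ∈ semiCouplings HX.μ HY.μ, ⨅ g' ∈ semiCouplings HX.μ' HY.μ',
    ccotLoss Ω δ HX HY g g' ^ (1 / 2 : ℝ)

/-! ### Independence of the reference measure -/

/-- The explicit form of the integrand. -/
theorem ofReal_coneDist_sq {Ω : ℝ → ℝ} (hΩ : IsConeFunction Ω) {δ : ℝ} (hδ : 0 < δ) (a b : ℝ)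
    (r s r' s' : ℝ≥0) :
    ENNReal.ofReal (coneDist Ω δ (MetricCone.mk a (NNReal.sqrt (r * r')))
      (MetricCone.mk b (NNReal.sqrt (s * s'))) ^ 2) =
    ENNReal.ofReal (4 * δ ^ 2 * ((r : ℝ) * r' + s * s'
      - 2 * √(r * r') * √(s * s') * Ω (|a - b| / (2 * δ)))) := by
  have hΩ' := hΩ.mem_Icc (|a - b| / (2 * δ)) (by positivity)
  congr 1
  change √(4 * δ ^ 2 * (((NNReal.sqrt (r * r') : ℝ≥0) : ℝ) ^ 2
    + ((NNReal.sqrt (s * s') : ℝ≥0) : ℝ) ^ 2 - 2 * ((NNReal.sqrt (r * r') : ℝ≥0) : ℝ)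
    * ((NNReal.sqrt (s * s') : ℝ≥0) : ℝ) * Ω (dist a b / (2 * δ)))) ^ 2 = _
  rw [Real.dist_eq, Real.coe_sqrt, Real.coe_sqrt, NNReal.coe_mul, NNReal.coe_mul, Real.sq_sqrt,
    Real.sq_sqrt (by positivity), Real.sq_sqrt (by positivity)]
  have h1 := Real.sqrt_nonneg ((r : ℝ) * r')
  have h2 := Real.sqrt_nonneg ((s : ℝ) * s')
  have h3 := mul_nonneg h1 h2
  have : 0 ≤ √((r : ℝ) * r') ^ 2 + √((s : ℝ) * s') ^ 2
      - 2 * √((r : ℝ) * r') * √((s : ℝ) * s') * Ω (|a - b| / (2 * δ)) := by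
    nlinarith [sq_nonneg (√((r : ℝ) * r') - √((s : ℝ) * s')), hΩ'.1, hΩ'.2,
      mul_nonneg h3 (sub_nonneg.2 hΩ'.2)]
  positivity

theorem measurable_cone_kernel {Ω : ℝ → ℝ} (hΩ : IsConeFunction Ω) {δ : ℝ} (hδ : 0 < δ)
    (HX : MeasureHypernetwork X X') (HY : MeasureHypernetwork Y Y') :
    Measurable fun z : (X × Y) × (X' × Y') =>
      Ω (|HX.ω (z.1.1, z.2.1) - HY.ω (z.1.2, z.2.2)| / (2 * δ)) := by
  have hanti : Antitone fun t : ℝ => Ω (max t 0) := by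
    intro s t hst
    have h0 : 0 ≤ max t 0 - max s 0 := sub_nonneg.2 (max_le_max_right 0 hst)
    have h1 := hΩ.map_add_le (max s 0) (max t 0 - max s 0) (le_max_right _ _) h0
    rw [add_sub_cancel] at h1
    exact h1.trans (mul_le_of_le_one_right (hΩ.mem_Icc _ (le_max_right _ _)).1 (hΩ.mem_Icc _ h0).2)
  have hX : Measurable fun z : (X × Y) × (X' × Y') => HX.ω (z.1.1, z.2.1) :=
    HX.measurable_ω.comp (by fun_prop)
  have hY : Measurable fun z : (X × Y) × (X' × Y') => HY.ω (z.1.2, z.2.2) :=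
    HY.measurable_ω.comp (by fun_prop)
  have hm : Measurable fun z : (X × Y) × (X' × Y') =>
      |HX.ω (z.1.1, z.2.1) - HY.ω (z.1.2, z.2.2)| / (2 * δ) := by
    have := (hX.sub hY).abs
    exact this.div_const _
  have h := hanti.measurable.comp hm
  have heq : (fun z : (X × Y) × (X' × Y') =>
      Ω (|HX.ω (z.1.1, z.2.1) - HY.ω (z.1.2, z.2.2)| / (2 * δ))) =
      (fun t : ℝ => Ω (max t 0)) ∘ fun z : (X × Y) × (X' × Y') =>
        |HX.ω (z.1.1, z.2.1) - HY.ω (z.1.2, z.2.2)| / (2 * δ) := by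
    funext z
    have h0 : 0 ≤ |HX.ω (z.1.1, z.2.1) - HY.ω (z.1.2, z.2.2)| / (2 * δ) := by positivity
    simp only [Function.comp_apply, max_eq_left h0]
  rw [heq]
  exact h

/-- The value of the CCOT loss does not depend on the reference measures. -/
theorem ccotLossRef_eq_ccotLoss {Ω : ℝ → ℝ} (hΩ : IsConeFunction Ω) {δ : ℝ} (hδ : 0 < δ)
    (HX : MeasureHypernetwork X X') (HY : MeasureHypernetwork Y Y')
    (γ : Measure (X × Y)) (γ' : Measure (X' × Y')) [SigmaFinite γ] [SigmaFinite γ']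
    (g : Measure (X × Y) × Measure (X × Y)) (g' : Measure (X' × Y') × Measure (X' × Y'))
    [IsFiniteMeasure g.1] [IsFiniteMeasure g.2] [IsFiniteMeasure g'.1] [IsFiniteMeasure g'.2]
    (h0 : g.1 ≪ γ) (h1 : g.2 ≪ γ) (h0' : g'.1 ≪ γ') (h1' : g'.2 ≪ γ') :
    ccotLossRef Ω δ HX HY γ γ' g g' = ccotLoss Ω δ HX HY g g' := by
  unfold ccotLoss ccotLossRef
  simp only [ofReal_coneDist_sq hΩ hδ]
  have hκ := measurable_cone_kernel hΩ hδ HX HY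
  have hmeas : ∀ (η : Measure (X × Y)) (η' : Measure (X' × Y')),
      Measurable fun z : (X × Y) × (X' × Y') => ENNReal.ofReal (4 * δ ^ 2 *
        (((g.1.rnDeriv η z.1).toNNReal : ℝ) * (g'.1.rnDeriv η' z.2).toNNReal
          + ((g.2.rnDeriv η z.1).toNNReal : ℝ) * (g'.2.rnDeriv η' z.2).toNNReal
          - 2 * √(((g.1.rnDeriv η z.1).toNNReal : ℝ) * (g'.1.rnDeriv η' z.2).toNNReal)
            * √(((g.2.rnDeriv η z.1).toNNReal : ℝ) * (g'.2.rnDeriv η' z.2).toNNReal)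
            * Ω (|HX.ω (z.1.1, z.2.1) - HY.ω (z.1.2, z.2.2)| / (2 * δ)))) := by
    intro η η'
    have m0 : Measurable fun z : (X × Y) × (X' × Y') => ((g.1.rnDeriv η z.1).toNNReal : ℝ) :=
      ((Measure.measurable_rnDeriv _ _).comp measurable_fst).ennreal_toNNReal.coe_nnreal_real
    have m1 : Measurable fun z : (X × Y) × (X' × Y') => ((g.2.rnDeriv η z.1).toNNReal : ℝ) :=
      ((Measure.measurable_rnDeriv _ _).comp measurable_fst).ennreal_toNNReal.coe_nnreal_real
    have m0' : Measurable fun z : (X × Y) × (X' × Y') => ((g'.1.rnDeriv η' z.2).toNNReal : ℝ) :=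
      ((Measure.measurable_rnDeriv _ _).comp measurable_snd).ennreal_toNNReal.coe_nnreal_real
    have m1' : Measurable fun z : (X × Y) × (X' × Y') => ((g'.2.rnDeriv η' z.2).toNNReal : ℝ) :=
      ((Measure.measurable_rnDeriv _ _).comp measurable_snd).ennreal_toNNReal.coe_nnreal_real
    exact ((((m0.mul m0').add (m1.mul m1')).sub ((((m0.mul m0').sqrt.const_mul 2).mul
      (m1.mul m1').sqrt).mul hκ)).const_mul _).ennreal_ofReal
  have hρ : g.1 + g.2 ≪ γ := Measure.AbsolutelyContinuous.add_left_iff.2 ⟨h0, h1⟩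
  have hρ' : g'.1 + g'.2 ≪ γ' := Measure.AbsolutelyContinuous.add_left_iff.2 ⟨h0', h1'⟩
  have a0 := Measure.rnDeriv_mul_rnDeriv (κ := γ)
    (show g.1 ≪ g.1 + g.2 from Measure.AbsolutelyContinuous.rfl.add_right _)
  have a1 := Measure.rnDeriv_mul_rnDeriv (κ := γ)
    (show g.2 ≪ g.1 + g.2 from (add_comm g.2 g.1) ▸ Measure.AbsolutelyContinuous.rfl.add_right _)
  have a0' := Measure.rnDeriv_mul_rnDeriv (κ := γ')
    (show g'.1 ≪ g'.1 + g'.2 from Measure.AbsolutelyContinuous.rfl.add_right _)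
  have a1' := Measure.rnDeriv_mul_rnDeriv (κ := γ')
    (show g'.2 ≪ g'.1 + g'.2 from
      (add_comm g'.2 g'.1) ▸ Measure.AbsolutelyContinuous.rfl.add_right _)
  have ht := Measure.rnDeriv_ne_top (g.1 + g.2) γ
  have ht' := Measure.rnDeriv_ne_top (g'.1 + g'.2) γ'
  rw [lintegral_prod _ (hmeas _ _).aemeasurable, lintegral_prod _ (hmeas _ _).aemeasurable,
    ← lintegral_rnDeriv_mul hρ (hmeas _ _).lintegral_prod_right'.aemeasurable]
  refine lintegral_congr_ae ?_
  filter_upwards [a0, a1, ht] with p ha0 ha1 hp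
  have hin := (hmeas (g.1 + g.2) (g'.1 + g'.2)).comp (measurable_prodMk_left (x := p))
  simp only [Function.comp_def] at hin
  rw [← lintegral_rnDeriv_mul hρ' hin.aemeasurable, ← lintegral_const_mul' _ _ hp]
  refine lintegral_congr_ae ?_
  filter_upwards [a0', a1', ht'] with q ha0' ha1' hq
  simp only [Pi.mul_apply] at ha0 ha1 ha0' ha1' ⊢
  rw [← ha0, ← ha1, ← ha0', ← ha1']
  obtain ⟨u, hu⟩ : ∃ u : ℝ≥0, (u : ℝ≥0∞) = (g.1 + g.2).rnDeriv γ p :=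
    ⟨_, ENNReal.coe_toNNReal hp⟩
  obtain ⟨v, hv⟩ : ∃ v : ℝ≥0, (v : ℝ≥0∞) = (g'.1 + g'.2).rnDeriv γ' q :=
    ⟨_, ENNReal.coe_toNNReal hq⟩
  rw [← hu, ← hv]
  simp only [ENNReal.toNNReal_mul, ENNReal.toNNReal_coe, NNReal.coe_mul]
  have key : ∀ a b : ℝ≥0, √((a : ℝ) * u * (b * v)) = √((u : ℝ) * v) * √((a : ℝ) * b) := by
    intro a b
    rw [← Real.sqrt_mul (by positivity)]
    congr 1
    ring
  rw [key, key, ← ENNReal.ofReal_coe_nnreal, ← ENNReal.ofReal_coe_nnreal,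
    ← ENNReal.ofReal_mul (by positivity), ← ENNReal.ofReal_mul (by positivity)]
  congr 1
  have hs : √((u : ℝ) * v) * √((u : ℝ) * v) = u * v := Real.mul_self_sqrt (by positivity)
  linear_combination (-8 * δ ^ 2 * √(((g.1.rnDeriv (g.1 + g.2) p).toNNReal : ℝ) *
    ((g'.1.rnDeriv (g'.1 + g'.2) q).toNNReal)) * √(((g.2.rnDeriv (g.1 + g.2) p).toNNReal : ℝ) *
    ((g'.2.rnDeriv (g'.1 + g'.2) q).toNNReal)) *
    Ω (|HX.ω (p.1, q.1) - HY.ω (p.2, q.2)| / (2 * δ))) * hs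

/-- The value of the CGW loss does not depend on the reference measure. -/
theorem cgwLossRef_eq_cgwLoss {Ω : ℝ → ℝ} (hΩ : IsConeFunction Ω) {δ : ℝ} (hδ : 0 < δ)
    (NX : MeasureNetwork X) (NY : MeasureNetwork Y) (γ : Measure (X × Y)) [SigmaFinite γ]
    (g : Measure (X × Y) × Measure (X × Y)) [IsFiniteMeasure g.1] [IsFiniteMeasure g.2]
    (h0 : g.1 ≪ γ) (h1 : g.2 ≪ γ) :
    cgwLossRef Ω δ NX NY γ g = cgwLoss Ω δ NX NY g :=
  ccotLossRef_eq_ccotLoss hΩ hδ NX.toHypernetwork NY.toHypernetwork γ γ g g h0 h1 h0 h1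

end Losses

/-! Expanding the squared cone distance shows that the loss of two semi-couplings `g`, `g'` is a
constant minus `8δ² Q(f, f')`. The constant depends only on the total masses, which the marginal
constraints fix. Here `f`, `f'` are the geometric means of the densities of each pair, and `Q` is
the bilinear form of the kernel `k`. If `k` is positive definite, then `Q(f - f', f - f') ≥ 0`, that
is, `2 Q(f, f') ≤ Q(f, f) + Q(f', f')`, and therefore `L(g, g) + L(g', g') ≤ 2 L(g, g')`. So one of
the diagonal pairs is never worse than `(g, g')`, and at a minimiser both are equally good. On the
diagonal the CCOT loss is the CGW loss. Two points carry the analysis: positivity on finite samples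
passes to integrals (`integral_prod_nonneg_of_sum_nonneg`), and the loss has the stated bilinear
form (`ccotLoss_eq_ofReal`). `ccotLoss_self_add_ccotLoss_self_le` combines them. -/

/-! ### Integral positivity of positive definite kernels -/

/-- A finite-sample positive kernel is integrally positive: the average of the nonnegative double
sums over `n` independent samples equals `n (n - 1) ∬ K + n ∫ K (z, z)`, and `n` is arbitrary. -/
theorem integral_prod_nonneg_of_sum_nonneg {Z : Type*} [MeasurableSpace Z] (ν : Measure Z)
    [IsProbabilityMeasure ν] {K : Z × Z → ℝ}
    (hK : ∀ (n : ℕ) (z : Fin n → Z), 0 ≤ ∑ i, ∑ j, K (z i, z j))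
    (hint : Integrable K (ν.prod ν)) (hdiag : Integrable (fun z => K (z, z)) ν) :
    0 ≤ ∫ p, K p ∂(ν.prod ν) := by
  have hmp : ∀ {n : ℕ} {i j : Fin n}, i ≠ j →
      MeasurePreserving (fun z : Fin n → Z => (z i, z j)) (Measure.pi fun _ => ν) (ν.prod ν) := by
    intro n i j hij
    refine ⟨by fun_prop, ?_⟩
    -- Distinct coordinates of the product measure are independent, so their joint law is `ν ⊗ ν`.
    have hind := (ProbabilityTheory.iIndepFun_pi (μ := fun _ : Fin n => ν)
      (X := fun _ => id) fun _ => aemeasurable_id).indepFun hij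
    have h : _ = (Measure.map (Function.eval i) _).prod (Measure.map (Function.eval j) _) :=
      hind.map_prod_eq_prod_map_map (measurable_pi_apply i).aemeasurable
      (measurable_pi_apply j).aemeasurable
    rw [(measurePreserving_eval (fun _ : Fin n => ν) i).map_eq,
      (measurePreserving_eval (fun _ : Fin n => ν) j).map_eq] at h
    exact h
  set I := ∫ p, K p ∂(ν.prod ν)
  set D := ∫ z, K (z, z) ∂ν
  have hterm : ∀ {n : ℕ} (i j : Fin n),
      Integrable (fun z : Fin n → Z => K (z i, z j)) (Measure.pi fun _ => ν) ∧
      ∫ z : Fin n → Z, K (z i, z j) ∂(Measure.pi fun _ => ν) = if i = j then D else I := by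
    intro n i j
    split_ifs with hij
    · subst hij
      have hi := measurePreserving_eval (fun _ : Fin n => ν) i
      refine ⟨hi.integrable_comp_of_integrable hdiag, ?_⟩
      have hd : AEStronglyMeasurable (fun z => K (z, z))
          ((Measure.pi fun _ : Fin n => ν).map (Function.eval i)) := by
        rw [hi.map_eq]; exact hdiag.aestronglyMeasurable
      have h := integral_map hi.measurable.aemeasurable hd
      rw [hi.map_eq] at h
      exact h.symm
    · have hi := hmp hij
      refine ⟨hi.integrable_comp_of_integrable hint, ?_⟩
      have hd : AEStronglyMeasurable K
          ((Measure.pi fun _ : Fin n => ν).map fun z => (z i, z j)) := by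
        rw [hi.map_eq]; exact hint.aestronglyMeasurable
      have h := integral_map hi.measurable.aemeasurable hd
      rw [hi.map_eq] at h
      exact h.symm
  -- Expected double sum: `n` diagonal terms `D` and `n² - n` off-diagonal terms `I`.
  have hn : ∀ n : ℕ, 0 ≤ (n : ℝ) * (D - I) + (n : ℝ) * n * I := by
    intro n
    have h0 : 0 ≤ ∫ z : Fin n → Z, ∑ i, ∑ j, K (z i, z j) ∂(Measure.pi fun _ => ν) :=
      integral_nonneg fun z => hK n z
    rw [integral_finsetSum _ fun i _ => integrable_finsetSum _ fun j _ => (hterm i j).1] at h0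
    simp_rw [integral_finsetSum _ fun j _ => (hterm _ j).1, (hterm _ _).2] at h0
    have hs : ∀ i j : Fin n, (if i = j then D else I) = (if i = j then D - I else 0) + I := by
      intro i j; split_ifs <;> ring
    simp only [hs, Finset.sum_add_distrib, Finset.sum_ite_eq, Finset.mem_univ, if_true,
      Finset.sum_const, Finset.card_univ, Fintype.card_fin, nsmul_eq_mul] at h0
    linarith
  by_contra hneg
  push Not at hneg
  -- If `I < 0`, the quadratic term wins once the sample size exceeds `(D - I) / -I`; using `n + 1`
  -- keeps the size positive.
  obtain ⟨n, hn'⟩ := exists_nat_gt ((D - I) / -I)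
  have hpos : 0 < ((n + 1 : ℕ) : ℝ) := by positivity
  have h1 := hn (n + 1)
  have h2 : D - I < ((n + 1 : ℕ) : ℝ) * -I := by
    rw [div_lt_iff₀ (by linarith)] at hn'
    push_cast
    nlinarith
  nlinarith

/-- A bounded measurable positive semidefinite kernel defines a nonnegative quadratic form. -/
theorem Matrix.PosSemidef.integral_prod_nonneg {Z : Type*} [MeasurableSpace Z] (ρ : Measure Z)
    [IsFiniteMeasure ρ] {k : Z → Z → ℝ} (hk : (Matrix.of k).PosSemidef)
    (hm : Measurable (Function.uncurry k)) {C : ℝ} (hC : ∀ z w, |k z w| ≤ C) {F : Z → ℝ}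
    (hF : Integrable F ρ) (hF2 : Integrable (fun z => F z * F z) ρ) :
    0 ≤ ∫ p : Z × Z, F p.1 * F p.2 * k p.1 p.2 ∂(ρ.prod ρ) := by
  rcases eq_or_ne ρ 0 with rfl | hρ
  · simp
  have : NeZero ρ := ⟨hρ⟩
  -- Normalising to a probability measure multiplies the double integral by `c² > 0`, which leaves
  -- its sign unchanged.
  set c := (ρ Set.univ)⁻¹
  have hc : c ≠ ⊤ := by simp [c, hρ]
  have hc0 : c ≠ 0 := by simp [c]
  have h := integral_prod_nonneg_of_sum_nonneg (c • ρ)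
    (K := fun p => F p.1 * F p.2 * k p.1 p.2) ?_ ?_ ?_
  · rw [Measure.prod_smul_left, Measure.prod_smul_right, smul_smul, integral_smul_measure,
      smul_eq_mul] at h
    exact nonneg_of_mul_nonneg_right h
      (ENNReal.toReal_pos (mul_ne_zero hc0 hc0) (ENNReal.mul_ne_top hc hc))
  · intro n z
    -- The sample may repeat points; a submatrix along a non-injective map is still positive
    -- semidefinite.
    have h := (hk.submatrix z).dotProduct_mulVec_nonneg (fun i => F (z i))
    simp only [dotProduct, Matrix.mulVec, Finset.mul_sum, Matrix.submatrix_apply,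
      Matrix.of_apply, Pi.star_apply, star_trivial] at h
    refine h.trans_eq (Finset.sum_congr rfl fun i _ => Finset.sum_congr rfl fun j _ => ?_)
    ring
  · have hF' := hF.smul_measure hc
    exact (hF'.mul_prod hF').mul_bdd (c := C) hm.aestronglyMeasurable
      (Filter.Eventually.of_forall fun p => hC p.1 p.2)
  · exact (hF2.smul_measure hc).mul_bdd (c := C)
      (hm.comp (measurable_id.prodMk measurable_id)).aestronglyMeasurable
      (Filter.Eventually.of_forall fun z => hC z z)

/-- The mixed term of a positive semidefinite kernel is at most the mean of the pure terms. -/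
theorem Matrix.PosSemidef.two_mul_integral_prod_le {Z : Type*} [MeasurableSpace Z] (ρ : Measure Z)
    [IsFiniteMeasure ρ] {k : Z → Z → ℝ} (hk : (Matrix.of k).PosSemidef)
    (hm : Measurable (Function.uncurry k)) {C : ℝ} (hC : ∀ z w, |k z w| ≤ C) {f f' : Z → ℝ}
    (hf : MemLp f 2 ρ) (hf' : MemLp f' 2 ρ) :
    2 * ∫ p : Z × Z, f p.1 * f' p.2 * k p.1 p.2 ∂(ρ.prod ρ) ≤
      ∫ p : Z × Z, f p.1 * f p.2 * k p.1 p.2 ∂(ρ.prod ρ) +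
        ∫ p : Z × Z, f' p.1 * f' p.2 * k p.1 p.2 ∂(ρ.prod ρ) := by
  have hL := hf.integrable (by norm_num)
  have hL' := hf'.integrable (by norm_num)
  have hint : ∀ {u v : Z → ℝ}, Integrable u ρ → Integrable v ρ →
      Integrable (fun p : Z × Z => u p.1 * v p.2 * k p.1 p.2) (ρ.prod ρ) := fun hu hv =>
    (hu.mul_prod hv).mul_bdd (c := C) hm.aestronglyMeasurable
      (Filter.Eventually.of_forall fun p => hC p.1 p.2)
  have hsymm : ∀ z w, k z w = k w z := fun z w => by simpa using (hk.isHermitian.apply z w).symm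
  have hswap : ∫ p : Z × Z, f' p.1 * f p.2 * k p.1 p.2 ∂(ρ.prod ρ) =
      ∫ p : Z × Z, f p.1 * f' p.2 * k p.1 p.2 ∂(ρ.prod ρ) := by
    rw [← integral_prod_swap]
    refine integral_congr_ae (Filter.Eventually.of_forall fun p => ?_)
    simp only [Prod.fst_swap, Prod.snd_swap, hsymm p.2 p.1]
    ring
  have hF := hf.sub hf'
  -- Positivity is applied to `f - f'`; by symmetry of `k` the two cross terms agree.
  have h := hk.integral_prod_nonneg ρ hm hC (hF.integrable (by norm_num))
    (hF.integrable_mul hF)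
  have hexp : ∀ p : Z × Z, (f - f') p.1 * (f - f') p.2 * k p.1 p.2 =
      (f p.1 * f p.2 * k p.1 p.2 - f p.1 * f' p.2 * k p.1 p.2) -
        (f' p.1 * f p.2 * k p.1 p.2 - f' p.1 * f' p.2 * k p.1 p.2) := by
    intro p; simp only [Pi.sub_apply]; ring
  have hsub := integral_sub ((hint hL hL).sub (hint hL hL')) ((hint hL' hL).sub (hint hL' hL'))
  simp only [Pi.sub_apply] at hsub
  simp_rw [hexp] at h
  rw [hsub, integral_sub (hint hL hL) (hint hL hL'), integral_sub (hint hL' hL) (hint hL' hL'),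
    hswap] at h
  linarith

/-! ### Masses and densities of semi-couplings -/

theorem isFiniteMeasure_of_mem_semiCouplings {X Y : Type*} [MeasurableSpace X] [MeasurableSpace Y]
    {μ : Measure X} {ν : Measure Y} [IsFiniteMeasure μ] [IsFiniteMeasure ν]
    {g : Measure (X × Y) × Measure (X × Y)} (hg : g ∈ semiCouplings μ ν) :
    IsFiniteMeasure g.1 ∧ IsFiniteMeasure g.2 := by
  refine ⟨⟨?_⟩, ⟨?_⟩⟩
  · rw [← Set.preimage_univ (f := Prod.fst), ← Measure.map_apply measurable_fst .univ, hg.1]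
    exact measure_lt_top _ _
  · rw [← Set.preimage_univ (f := Prod.snd), ← Measure.map_apply measurable_snd .univ, hg.2]
    exact measure_lt_top _ _

theorem measureReal_univ_of_mem_semiCouplings {X Y : Type*} [MeasurableSpace X]
    [MeasurableSpace Y] {μ : Measure X} {ν : Measure Y} {g : Measure (X × Y) × Measure (X × Y)}
    (hg : g ∈ semiCouplings μ ν) :
    g.1.real Set.univ = μ.real Set.univ ∧ g.2.real Set.univ = ν.real Set.univ := by
  constructor
  · rw [← hg.1, map_measureReal_apply measurable_fst .univ, Set.preimage_univ]
  · rw [← hg.2, map_measureReal_apply measurable_snd .univ, Set.preimage_univ]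

/-- The geometric mean of the densities of two measures with respect to a reference measure. -/
noncomputable def sqrtDensity {Z : Type*} [MeasurableSpace Z] (ρ : Measure Z)
    (g : Measure Z × Measure Z) (z : Z) : ℝ :=
  √((g.1.rnDeriv ρ z).toReal * (g.2.rnDeriv ρ z).toReal)

/-- Domination `≤ ρ`, rather than mere absolute continuity, bounds both densities by `1`, so their
geometric mean is bounded and hence square integrable for the finite measure `ρ`. -/
theorem memLp_sqrtDensity {Z : Type*} [MeasurableSpace Z] {ρ : Measure Z} [IsFiniteMeasure ρ]
    {g : Measure Z × Measure Z} (h1 : g.1 ≤ ρ) (h2 : g.2 ≤ ρ) : MemLp (sqrtDensity ρ g) 2 ρ := by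
  refine MemLp.of_bound (C := 1) ?_ ?_
  · exact (((Measure.measurable_rnDeriv _ _).ennreal_toReal.mul
      (Measure.measurable_rnDeriv _ _).ennreal_toReal).sqrt).aestronglyMeasurable
  · filter_upwards [Measure.rnDeriv_le_one_of_le h1, Measure.rnDeriv_le_one_of_le h2] with z ha hb
    have ha' := ENNReal.toReal_mono ENNReal.one_ne_top ha
    have hb' := ENNReal.toReal_mono ENNReal.one_ne_top hb
    simp only [ENNReal.toReal_one] at ha' hb'
    rw [sqrtDensity, Real.norm_of_nonneg (Real.sqrt_nonneg _)]
    exact Real.sqrt_le_one.2 (mul_le_one₀ ha' ENNReal.toReal_nonneg hb')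

/-! ### The loss as a bilinear form -/

section Losses

variable {X Y : Type*}
  [TopologicalSpace X] [CompactSpace X] [PolishSpace X] [MeasurableSpace X] [BorelSpace X]
  [TopologicalSpace Y] [CompactSpace Y] [PolishSpace Y] [MeasurableSpace Y] [BorelSpace Y]

/-- The CCOT loss between measure networks is a constant minus a bilinear expression in the square
roots of the densities. -/
theorem ccotLoss_eq_ofReal {Ω : ℝ → ℝ} (hΩ : IsConeFunction Ω) {δ : ℝ} (hδ : 0 < δ)
    (NX : MeasureNetwork X) (NY : MeasureNetwork Y) (ρ : Measure (X × Y)) [IsFiniteMeasure ρ]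
    {g g' : Measure (X × Y) × Measure (X × Y)}
    (hg : g ∈ semiCouplings NX.μ NY.μ) (hg' : g' ∈ semiCouplings NX.μ NY.μ)
    (h1 : g.1 ≤ ρ) (h2 : g.2 ≤ ρ) (h1' : g'.1 ≤ ρ) (h2' : g'.2 ≤ ρ) :
    ∃ V : ℝ, 0 ≤ V ∧ V = 4 * δ ^ 2 * (NX.μ.real Set.univ ^ 2 + NY.μ.real Set.univ ^ 2
        - 2 * ∫ p : (X × Y) × (X × Y), sqrtDensity ρ g p.1 * sqrtDensity ρ g' p.2 *
          Ω (|NX.ω (p.1.1, p.2.1) - NY.ω (p.1.2, p.2.2)| / (2 * δ)) ∂(ρ.prod ρ)) ∧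
      ccotLoss Ω δ NX.toHypernetwork NY.toHypernetwork g g' = ENNReal.ofReal V := by
  have := NX.finite_μ
  have := NY.finite_μ
  obtain ⟨_, _⟩ := isFiniteMeasure_of_mem_semiCouplings hg
  obtain ⟨_, _⟩ := isFiniteMeasure_of_mem_semiCouplings hg'
  have hκ : Measurable fun p : (X × Y) × (X × Y) =>
      Ω (|NX.ω (p.1.1, p.2.1) - NY.ω (p.1.2, p.2.2)| / (2 * δ)) :=
    measurable_cone_kernel hΩ hδ NX.toHypernetwork NY.toHypernetwork
  have hκ01 : ∀ p : (X × Y) × (X × Y),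
      Ω (|NX.ω (p.1.1, p.2.1) - NY.ω (p.1.2, p.2.2)| / (2 * δ)) ∈ Set.Icc (0 : ℝ) 1 :=
    fun p => hΩ.mem_Icc _ (by positivity)
  have hi (η : Measure (X × Y)) [IsFiniteMeasure η] :
      Integrable (fun z => (η.rnDeriv ρ z).toReal) ρ := Measure.integrable_toReal_rnDeriv
  have hf := (memLp_sqrtDensity h1 h2).integrable (by norm_num)
  have hf' := (memLp_sqrtDensity h1' h2').integrable (by norm_num)
  have hA := (hi g.1).mul_prod (hi g'.1)
  have hB := (hi g.2).mul_prod (hi g'.2)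
  have hQ := (hf.mul_prod hf').mul_bdd (c := 1) hκ.aestronglyMeasurable
    (Filter.Eventually.of_forall fun p => by
      rw [Real.norm_of_nonneg (hκ01 p).1]; exact (hκ01 p).2)
  set G : (X × Y) × (X × Y) → ℝ := fun p => 4 * δ ^ 2 *
    ((g.1.rnDeriv ρ p.1).toReal * (g'.1.rnDeriv ρ p.2).toReal +
      (g.2.rnDeriv ρ p.1).toReal * (g'.2.rnDeriv ρ p.2).toReal -
      2 * (sqrtDensity ρ g p.1 * sqrtDensity ρ g' p.2 *
        Ω (|NX.ω (p.1.1, p.2.1) - NY.ω (p.1.2, p.2.2)| / (2 * δ)))) with hG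
  -- Regrouping the four densities separates the variables: the loss pairs them across the two
  -- points, `sqrtDensity` pairs them at a single point.
  have hsq : ∀ p : (X × Y) × (X × Y), sqrtDensity ρ g p.1 * sqrtDensity ρ g' p.2 =
      √((g.1.rnDeriv ρ p.1).toReal * (g'.1.rnDeriv ρ p.2).toReal) *
        √((g.2.rnDeriv ρ p.1).toReal * (g'.2.rnDeriv ρ p.2).toReal) := by
    intro p
    rw [sqrtDensity, sqrtDensity, ← Real.sqrt_mul (by positivity),
      ← Real.sqrt_mul (by positivity)]
    congr 1
    ring
  -- Since `Ω ≤ 1`, the bracket is at least `(√s - √t)²`.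
  have hG0 : ∀ p, 0 ≤ G p := by
    intro p
    obtain ⟨k0, k1⟩ := hκ01 p
    simp only [hG, hsq p]
    set s := (g.1.rnDeriv ρ p.1).toReal * (g'.1.rnDeriv ρ p.2).toReal
    set t := (g.2.rnDeriv ρ p.1).toReal * (g'.2.rnDeriv ρ p.2).toReal
    have hs0 : 0 ≤ s := by positivity
    have ht0 : 0 ≤ t := by positivity
    have h := mul_le_of_le_one_right (mul_nonneg (Real.sqrt_nonneg s) (Real.sqrt_nonneg t)) k1
    have h' := sq_nonneg (√s - √t)
    have := Real.sq_sqrt hs0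
    have := Real.sq_sqrt ht0
    exact mul_nonneg (by positivity) (by nlinarith)
  have hGi : Integrable G (ρ.prod ρ) := ((hA.add hB).sub (hQ.const_mul 2)).const_mul _
  have hmass (η : Measure (X × Y)) [IsFiniteMeasure η] (h : η ≤ ρ) :
      ∫ z, (η.rnDeriv ρ z).toReal ∂ρ = η.real Set.univ :=
    Measure.integral_toReal_rnDeriv (Measure.absolutelyContinuous_of_le h)
  refine ⟨∫ p, G p ∂(ρ.prod ρ), integral_nonneg hG0, ?_, ?_⟩
  · have m := measureReal_univ_of_mem_semiCouplings hg
    have m' := measureReal_univ_of_mem_semiCouplings hg'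
    have hsub := integral_sub (hA.add hB) (hQ.const_mul 2)
    simp only [Pi.add_apply] at hsub
    simp only [hG]
    rw [integral_const_mul, hsub, integral_add hA hB,
      integral_const_mul, integral_prod_mul (fun z => (g.1.rnDeriv ρ z).toReal)
        (fun z => (g'.1.rnDeriv ρ z).toReal), integral_prod_mul
        (fun z => (g.2.rnDeriv ρ z).toReal) (fun z => (g'.2.rnDeriv ρ z).toReal),
      hmass _ h1, hmass _ h2, hmass _ h1', hmass _ h2', m.1, m.2, m'.1, m'.2]
    ring
  · rw [← ccotLossRef_eq_ccotLoss hΩ hδ _ _ ρ ρ g g' (Measure.absolutelyContinuous_of_le h1)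
      (Measure.absolutelyContinuous_of_le h2) (Measure.absolutelyContinuous_of_le h1')
      (Measure.absolutelyContinuous_of_le h2'), ccotLossRef,
      ofReal_integral_eq_lintegral_ofReal hGi (Filter.Eventually.of_forall hG0)]
    simp only [ofReal_coneDist_sq hΩ hδ]
    refine lintegral_congr fun p => ?_
    simp only [hG, hsq p, ENNReal.coe_toNNReal_eq_toReal, MeasureNetwork.toHypernetwork]
    congr 1
    ring

/-- The mass terms on both sides cancel, leaving the inequality `2 Q(f, f') ≤ Q(f, f) + Q(f', f')`
with reversed sign. Finiteness is recorded because the minimiser argument cancels in `ℝ≥0∞`. -/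
theorem ccotLoss_self_add_ccotLoss_self_le {Ω : ℝ → ℝ} (hΩ : IsConeFunction Ω) {δ : ℝ}
    (hδ : 0 < δ) (NX : MeasureNetwork X) (NY : MeasureNetwork Y)
    (hk : (Matrix.of fun p q : X × Y =>
      Ω (|NX.ω (p.1, q.1) - NY.ω (p.2, q.2)| / (2 * δ))).PosSemidef)
    {g g' : Measure (X × Y) × Measure (X × Y)}
    (hg : g ∈ semiCouplings NX.μ NY.μ) (hg' : g' ∈ semiCouplings NX.μ NY.μ) :
    ccotLoss Ω δ NX.toHypernetwork NY.toHypernetwork g g' ≠ ⊤ ∧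
    ccotLoss Ω δ NX.toHypernetwork NY.toHypernetwork g g +
        ccotLoss Ω δ NX.toHypernetwork NY.toHypernetwork g' g' ≤
      ccotLoss Ω δ NX.toHypernetwork NY.toHypernetwork g g' +
        ccotLoss Ω δ NX.toHypernetwork NY.toHypernetwork g g' := by
  have := NX.finite_μ
  have := NY.finite_μ
  obtain ⟨_, _⟩ := isFiniteMeasure_of_mem_semiCouplings hg
  obtain ⟨_, _⟩ := isFiniteMeasure_of_mem_semiCouplings hg'
  -- One reference measure dominating all four measures, so that the three losses become values of
  -- the same bilinear form.
  set ρ := (g.1 + g.2) + (g'.1 + g'.2)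
  have h1 : g.1 ≤ ρ := Measure.le_add_right (Measure.le_add_right le_rfl)
  have h2 : g.2 ≤ ρ := Measure.le_add_right (Measure.le_add_left le_rfl)
  have h1' : g'.1 ≤ ρ := Measure.le_add_left (Measure.le_add_right le_rfl)
  have h2' : g'.2 ≤ ρ := Measure.le_add_left (Measure.le_add_left le_rfl)
  obtain ⟨V, hV0, hV, hL⟩ := ccotLoss_eq_ofReal hΩ hδ NX NY ρ hg hg' h1 h2 h1' h2'
  obtain ⟨V₁, hV0₁, hV₁, hL₁⟩ := ccotLoss_eq_ofReal hΩ hδ NX NY ρ hg hg h1 h2 h1 h2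
  obtain ⟨V₂, hV0₂, hV₂, hL₂⟩ := ccotLoss_eq_ofReal hΩ hδ NX NY ρ hg' hg' h1' h2' h1' h2'
  have hb : ∀ p q : X × Y, |Ω (|NX.ω (p.1, q.1) - NY.ω (p.2, q.2)| / (2 * δ))| ≤ 1 := by
    intro p q
    have h := hΩ.mem_Icc (|NX.ω (p.1, q.1) - NY.ω (p.2, q.2)| / (2 * δ)) (by positivity)
    rw [abs_of_nonneg h.1]
    exact h.2
  have hQ := hk.two_mul_integral_prod_le ρ
    (measurable_cone_kernel hΩ hδ NX.toHypernetwork NY.toHypernetwork) hb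
    (memLp_sqrtDensity h1 h2) (memLp_sqrtDensity h1' h2')
  rw [hL, hL₁, hL₂]
  refine ⟨ENNReal.ofReal_ne_top, ?_⟩
  -- `ENNReal.ofReal` truncates negative numbers; it is additive here because the values are
  -- nonnegative.
  rw [← ENNReal.ofReal_add hV0₁ hV0₂, ← ENNReal.ofReal_add hV0 hV0]
  refine ENNReal.ofReal_le_ofReal ?_
  rw [hV, hV₁, hV₂]
  have := mul_le_mul_of_nonneg_left hQ (show 0 ≤ 8 * δ ^ 2 by positivity)
  linarith

theorem CCOT_le {X' Y' : Type*}
    [TopologicalSpace X'] [CompactSpace X'] [PolishSpace X'] [MeasurableSpace X'] [BorelSpace X']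
    [TopologicalSpace Y'] [CompactSpace Y'] [PolishSpace Y'] [MeasurableSpace Y'] [BorelSpace Y']
    (Ω : ℝ → ℝ) (δ : ℝ) (HX : MeasureHypernetwork X X') (HY : MeasureHypernetwork Y Y')
    {g : Measure (X × Y) × Measure (X × Y)} {g' : Measure (X' × Y') × Measure (X' × Y')}
    (hg : g ∈ semiCouplings HX.μ HY.μ) (hg' : g' ∈ semiCouplings HX.μ' HY.μ') :
    CCOT Ω δ HX HY ≤ ccotLoss Ω δ HX HY g g' ^ (1 / 2 : ℝ) :=
  iInf₂_le_of_le g hg (iInf₂_le g' hg')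

end Losses

/-! ### Equality of CCOT and CGW -/

theorem theorem5p9 {X Y : Type*}
    [TopologicalSpace X] [CompactSpace X] [PolishSpace X] [MeasurableSpace X] [BorelSpace X]
    [TopologicalSpace Y] [CompactSpace Y] [PolishSpace Y] [MeasurableSpace Y] [BorelSpace Y]
    (NX : MeasureNetwork X) (NY : MeasureNetwork Y)
    (Ω : ℝ → ℝ) (hΩ : IsConeFunction Ω) (δ : ℝ) (hδ : 0 < δ)
    (hk : (Matrix.of fun p q : X × Y =>
      Ω (|NX.ω (p.1, q.1) - NY.ω (p.2, q.2)| / (2 * δ))).PosSemidef) :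
    (∀ g ∈ semiCouplings NX.μ NY.μ, ∀ g' ∈ semiCouplings NX.μ NY.μ,
      CCOT Ω δ NX.toHypernetwork NY.toHypernetwork
          = ccotLoss Ω δ NX.toHypernetwork NY.toHypernetwork g g' ^ (1 / 2 : ℝ) →
      CCOT Ω δ NX.toHypernetwork NY.toHypernetwork
          = ccotLoss Ω δ NX.toHypernetwork NY.toHypernetwork g g ^ (1 / 2 : ℝ) ∧
      CCOT Ω δ NX.toHypernetwork NY.toHypernetwork
          = ccotLoss Ω δ NX.toHypernetwork NY.toHypernetwork g' g' ^ (1 / 2 : ℝ) ∧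
      CCOT Ω δ NX.toHypernetwork NY.toHypernetwork = cgwLoss Ω δ NX NY g ^ (1 / 2 : ℝ) ∧
      CCOT Ω δ NX.toHypernetwork NY.toHypernetwork = cgwLoss Ω δ NX NY g' ^ (1 / 2 : ℝ)) ∧
    CCOT Ω δ NX.toHypernetwork NY.toHypernetwork = CGW Ω δ NX NY := by
  have hhalf : (0 : ℝ) < 1 / 2 := by norm_num
  refine ⟨fun g hg g' hg' h => ?_, le_antisymm ?_ ?_⟩
  · obtain ⟨hfin, hle⟩ := ccotLoss_self_add_ccotLoss_self_le hΩ hδ NX NY hk hg hg'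
    have h₁ : ccotLoss Ω δ NX.toHypernetwork NY.toHypernetwork g g' ≤
        ccotLoss Ω δ NX.toHypernetwork NY.toHypernetwork g g :=
      (ENNReal.rpow_le_rpow_iff hhalf).1 (h ▸ CCOT_le Ω δ NX.toHypernetwork NY.toHypernetwork hg hg)
    have h₂ : ccotLoss Ω δ NX.toHypernetwork NY.toHypernetwork g g' ≤
        ccotLoss Ω δ NX.toHypernetwork NY.toHypernetwork g' g' :=
      (ENNReal.rpow_le_rpow_iff hhalf).1
        (h ▸ CCOT_le Ω δ NX.toHypernetwork NY.toHypernetwork hg' hg')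
    -- With `L = L(g, g')` minimal, `L(g, g) + L ≤ L(g, g) + L(g', g') ≤ L + L`, and the finite `L`
    -- cancels; `e₂` is symmetric.
    have e₁ := h₁.antisymm (ENNReal.le_of_add_le_add_right hfin
      ((add_le_add_right h₂ _).trans hle))
    have e₂ := h₂.antisymm (ENNReal.le_of_add_le_add_left hfin
      ((add_le_add_left h₁ _).trans hle))
    have c₁ := h.trans (congrArg (· ^ (1 / 2 : ℝ)) e₁)
    have c₂ := h.trans (congrArg (· ^ (1 / 2 : ℝ)) e₂)
    -- `cgwLoss` at `g` and `ccotLoss` at `(g, g)` agree by definition, so the same proofs serve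
    -- twice.
    exact ⟨c₁, c₂, c₁, c₂⟩
  · exact le_iInf₂ fun g hg => CCOT_le Ω δ NX.toHypernetwork NY.toHypernetwork hg hg
  -- No minimiser is needed: for every pair, one of the two diagonal losses is at most the mixed
  -- loss.
  · refine le_iInf₂ fun g hg => le_iInf₂ fun g' hg' => ?_
    obtain ⟨-, hle⟩ := ccotLoss_self_add_ccotLoss_self_le hΩ hδ NX NY hk hg hg'
    have hmin : ccotLoss Ω δ NX.toHypernetwork NY.toHypernetwork g g ≤
          ccotLoss Ω δ NX.toHypernetwork NY.toHypernetwork g g' ∨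
        ccotLoss Ω δ NX.toHypernetwork NY.toHypernetwork g' g' ≤
          ccotLoss Ω δ NX.toHypernetwork NY.toHypernetwork g g' := by
      by_contra! hlt
      exact hle.not_gt (ENNReal.add_lt_add hlt.1 hlt.2)
    rcases hmin with h | h
    · exact iInf₂_le_of_le g hg (ENNReal.rpow_le_rpow h hhalf.le)
    · exact iInf₂_le_of_le g' hg' (ENNReal.rpow_le_rpow h hhalf.le)
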